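/- **Definitions.** Maps called cpc are completely positive and contractive. A cp map $\phi$ between C*-algebras is *order zero* if $\phi(a)\phi(b)=0$ whenever $a,b\ge 0$ and $ab=0$. The *rank* of a finite-dimensional C*-algebra is the dimension of a maximal abelian subalgebra. A *trace* is a tracial state. An endomorphism of $A$ is a (not necessarily unital) $^*$-homomorphism $A\to A$. Let $A$ be a unital C*-algebra, $\mathcal F\subseteq A$ finite, $\varepsilon>0$ and $d\in\{0,1,2,\dots\}$. A *contractive $(d,\mathcal F,\varepsilon)$-decomposable system* for $A$ is a triple $(F,\psi,\varphi)$ where $F=F^{(0)}\oplus\dots\oplus F^{(d)}$ is a finite-dimensional C*-algebra, $\psi\colon A\to F$ and $\varphi\colon F\to A$ are cpc maps, $\|\varphi(\psi(a))-a\|\le\varepsilon$ for all $a\in\mathcal F$, and $\varphi|_{F^{(i)}}$ is order zero for $i=0,\dots,d$. The *decomposition rank* $\mathrm{dr}(A)\in\{0,1,2,\dots,\infty\}$ is the least $d$ for which such systems exist for all finite $\mathcal F\subseteq A$ and all $\varepsilon>0$. Let $r_{\mathrm{dr}}(d,\mathcal F,\varepsilon)$ be the infimum of $\mathrm{rank}(F)$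 over all contractive $(d,\mathcal F,\varepsilon)$-decomposable systems. Let $\tau$ be a trace on $A$. An *$(\mathcal F,\varepsilon)$-quasidiagonal system* for $\tau$ is a triple $(F,\tau_F,\varphi)$ where $F$ is a finite-dimensional C*-algebra with a trace $\tau_F$ and $\varphi\colon A\to F$ is a cpc map such that $\|\varphi(ab)-\varphi(a)\varphi(b)\|\le\varepsilon$ and $|\tau(a)-\tau_F(\varphi(a))|\le\varepsilon$ for all $a,b\in\mathcal F$. The trace $\tau$ is *quasidiagonal* if such systems exist for all finite $\mathcal F\subseteq A$ and all $\varepsilon>0$. Let $\mathrm{rqd}_\tau(\mathcal F,\varepsilon)$ be the infimum of $\mathrm{rank}(F)$ over all $(\mathcal F,\varepsilon)$-quasidiagonal systems for $\tau$. For an endomorphism $\alpha$ of $A$ with $\mathrm{dr}(A)=d<\infty$ put, with $\mathcal F$ ranging over the finite subsets of $A$, $$\mathrm{ht}_{\mathrm{dr}}(\alpha)=\sup_{\mathcal F}\sup_{\varepsilon>0}\limsup_{n\to\infty}\tfrac1n\log r_{\mathrm{dr}}\bigl(d,\mathcal F\cup\alpha(\mathcal F)\cup\dots\cup\alpha^{n-1}(\mathcal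 F),\varepsilon\bigr),$$ $$\mathrm{hqd}_\tau(\alpha)=\sup_{\mathcal F}\sup_{\varepsilon>0}\limsup_{n\to\infty}\tfrac1n\log \mathrm{rqd}_\tau\bigl(\mathcal F\cup\alpha(\mathcal F)\cup\dots\cup\alpha^{n-1}(\mathcal F),\varepsilon\bigr),$$ where $\log 0=-\infty$ and $\log\infty=\infty$. **Proposition.** Let $A$ be a simple unital C*-algebra with finite decomposition rank, let $\alpha$ be an endomorphism of $A$, and let $\tau$ be a trace on $A$. Then $\tau$ is quasidiagonal (so that $\mathrm{hqd}_\tau(\alpha)$ is defined as a quasidiagonal entropy), and $$\mathrm{ht}_{\mathrm{dr}}(\alpha)\ \ge\ \mathrm{hqd}_\tau(\alpha).$$ -/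

import Mathlib

open scoped CStarAlgebra ENNReal

namespace ColouredEntropy

noncomputable section

/-! ### Basic notions for C*-algebras -/

/-- A C*-algebra is simple if it is nonzero and has no closed two-sided ideals other than `0` and
the whole algebra. -/
structure IsSimpleCStarAlgebra (A : Type*) [CStarAlgebra A] : Prop where
  nontrivial : Nontrivial A
  eq_bot_or_eq_top : ∀ I : TwoSidedIdeal A, IsClosed (I : Set A) → I = ⊥ ∨ I = ⊤

open scoped ComplexOrder in
/-- A trace on a unital C*-algebra, meaning a tracial state: a positive linear functional `τ` with
`τ 1 = 1` and `τ (a * b) = τ (b * a)`. -/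
structure TracialState (A : Type*) [CStarAlgebra A] [PartialOrder A] [StarOrderedRing A]
    extends A →ₚ[ℂ] ℂ where
  map_one' : toFun 1 = 1
  map_mul_comm' : ∀ a b : A, toFun (a * b) = toFun (b * a)

instance (A : Type*) [CStarAlgebra A] [PartialOrder A] [StarOrderedRing A] :
    CoeFun (TracialState A) (fun _ => A → ℂ) where
  coe τ := fun a => τ.toFun a

/-- A map is contractive if it does not increase norms. Together with `→CP` this gives the
completely positive contractive (cpc) maps. -/
def IsContractive {A B : Type*} [Norm A] [Norm B] (f : A → B) : Prop :=
  ∀ a, ‖f a‖ ≤ ‖a‖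

/-- A map is order zero if it sends orthogonal positive elements to orthogonal elements. -/
def IsOrderZero {A B : Type*} [Mul A] [Zero A] [LE A] [Mul B] [Zero B] (f : A → B) : Prop :=
  ∀ a b : A, 0 ≤ a → 0 ≤ b → a * b = 0 → f a * f b = 0

/-- A maximal abelian subalgebra of a C*-algebra: a *-subalgebra which is maximal among the
commutative *-subalgebras. -/
def IsMaximalAbelian {F : Type*} [CStarAlgebra F] (S : StarSubalgebra ℂ F) : Prop :=
  Maximal (fun T : StarSubalgebra ℂ F => ∀ x ∈ T, ∀ y ∈ T, x * y = y * x) S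

/-- The rank of a finite-dimensional C*-algebra: the dimension of a maximal abelian subalgebra.
(All maximal abelian subalgebras of a finite-dimensional C*-algebra have the same dimension; the
infimum selects this common value.) -/
def rank (F : Type*) [CStarAlgebra F] : ℕ :=
  sInf {r : ℕ | ∃ S : StarSubalgebra ℂ F, IsMaximalAbelian S ∧ Module.finrank ℂ S = r}

/-- Finite-dimensional C*-algebras, with their usual order. The zero algebra is allowed. Since every
finite-dimensional C*-algebra is isomorphic to a finite direct sum of matrix algebras, it is enough
to consider the ones living in `Type`. -/
structure FinDimCStarAlg where
  carrier : Type
  [cstarAlgebra : CStarAlgebra carrier]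
  [partialOrder : PartialOrder carrier]
  [starOrderedRing : StarOrderedRing carrier]
  [finiteDimensional : FiniteDimensional ℂ carrier]

instance : CoeSort FinDimCStarAlg Type := ⟨FinDimCStarAlg.carrier⟩

attribute [instance] FinDimCStarAlg.cstarAlgebra FinDimCStarAlg.partialOrder
  FinDimCStarAlg.starOrderedRing FinDimCStarAlg.finiteDimensional

/-! ### Decomposition rank -/

section Decomposition

variable (A : Type*) [CStarAlgebra A] [PartialOrder A] [StarOrderedRing A]

/-- `(F, ψ, φ)` is a contractive `(d, 𝓕, ε)`-decomposable system for `A`, where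
`F = F 0 ⊕ ⋯ ⊕ F d`: the maps `ψ` and `φ` are completely positive contractive, `φ ∘ ψ` is the
identity on `𝓕` up to `ε`, and each restriction of `φ` to a summand `F i` is order zero. (These
restrictions are automatically completely positive and contractive, since `φ` is.) -/
structure IsContractiveDecomposableSystem {A : Type*} [CStarAlgebra A] [PartialOrder A]
    [StarOrderedRing A] (d : ℕ) (𝓕 : Set A) (ε : ℝ) (F : Fin (d + 1) → FinDimCStarAlg)
    (ψ : A →CP ((i : Fin (d + 1)) → F i)) (φ : ((i : Fin (d + 1)) → F i) →CP A) : Prop where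
  approx : ∀ a ∈ 𝓕, ‖φ (ψ a) - a‖ ≤ ε
  contractive_down : IsContractive ψ
  contractive_up : IsContractive φ
  orderZero : ∀ i : Fin (d + 1), IsOrderZero (fun x : F i => φ (Pi.single i x))

/-- `A` has decomposition rank at most `d`. -/
def DecompositionRankLE (d : ℕ) : Prop :=
  ∀ 𝓕 : Set A, 𝓕.Finite → ∀ ε : ℝ, 0 < ε →
    ∃ (F : Fin (d + 1) → FinDimCStarAlg) (ψ : A →CP ((i : Fin (d + 1)) → F i))
      (φ : ((i : Fin (d + 1)) → F i) →CP A), IsContractiveDecomposableSystem d 𝓕 ε F ψ φ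

/-- The decomposition rank of `A`: the least `d` such that `A` has decomposition rank at most `d`,
and `∞` if there is no such `d`. -/
def decompositionRank : ℕ∞ :=
  ⨅ (d : ℕ) (_ : DecompositionRankLE A d), (d : ℕ∞)

end Decomposition

/-! ### Entropies -/

section Entropy

variable {A : Type*} [CStarAlgebra A] [PartialOrder A] [StarOrderedRing A]

/-- The set `𝓕 ∪ α(𝓕) ∪ ⋯ ∪ α^{n-1}(𝓕)`. -/
def orbitUnion (α : A →⋆ₙₐ[ℂ] A) (𝓕 : Set A) (n : ℕ) : Set A :=
  ⋃ k ∈ Set.Iio n, (⇑α)^[k] '' 𝓕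

/-- From a rank function `r(𝓕, ε)` with values in `{0, 1, …, ∞}`, the entropy
`sup_𝓕 sup_ε limsup_n (1/n) log r(𝓕 ∪ α(𝓕) ∪ ⋯ ∪ α^{n-1}(𝓕), ε)`, where `𝓕` ranges over the finite
subsets of `A` and `ε` over the positive reals; here `log 0 = -∞` and `log ∞ = ∞`. -/
def entropyOfRank (r : Set A → ℝ → ℕ∞) (α : A →⋆ₙₐ[ℂ] A) : EReal :=
  ⨆ (𝓕 : Set A) (_ : 𝓕.Finite) (ε : ℝ) (_ : 0 < ε),
    Filter.limsup
      (fun n : ℕ => ENNReal.log ((r (orbitUnion α 𝓕 n) ε : ℕ∞) : ℝ≥0∞) / (n : EReal))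
      Filter.atTop

/-- The contractive `(d, 𝓕, ε)`-decomposable rank: the least rank of `F` over all contractive
`(d, 𝓕, ε)`-decomposable systems `(F, ψ, φ)`, and `∞` if there is none. -/
def contractiveDecomposableRank (d : ℕ) (𝓕 : Set A) (ε : ℝ) : ℕ∞ :=
  sInf {r : ℕ∞ | ∃ (F : Fin (d + 1) → FinDimCStarAlg) (ψ : A →CP ((i : Fin (d + 1)) → F i))
    (φ : ((i : Fin (d + 1)) → F i) →CP A),
    IsContractiveDecomposableSystem d 𝓕 ε F ψ φ ∧ r = (rank ((i : Fin (d + 1)) → F i) : ℕ∞)}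

open Classical in
/-- The contractive coloured entropy `ht_dr(α)`, computed with `d` equal to the decomposition rank
of `A`, and equal to `∞` if `A` does not have finite decomposition rank. -/
def htDr (α : A →⋆ₙₐ[ℂ] A) : EReal :=
  if decompositionRank A = ⊤ then ⊤
  else entropyOfRank (contractiveDecomposableRank (decompositionRank A).toNat) α

/-- `(F, τF, φ)` is an `(𝓕, ε)`-quasidiagonal system for the trace `τ`: the map `φ : A → F` is
completely positive contractive, and, up to `ε`, it is multiplicative on `𝓕` and carries the trace
`τF` to `τ` on `𝓕`. -/
structure IsQuasidiagonalSystem (τ : TracialState A) (𝓕 : Set A) (ε : ℝ) (F : FinDimCStarAlg)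
    (τF : TracialState F) (φ : A →CP F) : Prop where
  contractive : IsContractive φ
  mul : ∀ a ∈ 𝓕, ∀ b ∈ 𝓕, ‖φ (a * b) - φ a * φ b‖ ≤ ε
  trace : ∀ a ∈ 𝓕, ‖τ a - τF (φ a)‖ ≤ ε

/-- The trace `τ` is quasidiagonal. -/
def IsQuasidiagonal (τ : TracialState A) : Prop :=
  ∀ 𝓕 : Set A, 𝓕.Finite → ∀ ε : ℝ, 0 < ε →
    ∃ (F : FinDimCStarAlg) (τF : TracialState F) (φ : A →CP F), IsQuasidiagonalSystem τ 𝓕 ε F τF φ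

/-- The `(𝓕, ε)`-quasidiagonal rank of `τ`: the least rank of `F` over all `(𝓕, ε)`-quasidiagonal
systems `(F, τF, φ)` for `τ`, and `∞` if there is none. -/
def quasidiagonalRank (τ : TracialState A) (𝓕 : Set A) (ε : ℝ) : ℕ∞ :=
  sInf {r : ℕ∞ | ∃ (F : FinDimCStarAlg) (τF : TracialState F) (φ : A →CP F),
    IsQuasidiagonalSystem τ 𝓕 ε F τF φ ∧ r = (rank F : ℕ∞)}

/-- The quasidiagonal entropy `hqd_τ(α)` of `α` with respect to `τ`. -/
def hqd (τ : TracialState A) (α : A →⋆ₙₐ[ℂ] A) : EReal :=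
  entropyOfRank (quasidiagonalRank τ) α

end Entropy

end

end ColouredEntropy

/-! A good decomposable system `(F, ψ, φ)` already contains a quasidiagonal system on the same
algebra `F`; ranks, and hence entropies, are then compared term by term.

Since `φ ∘ ψ` is nearly the identity, Kadison's inequality for `φ` makes `φ` small on the
multiplicative defect `ψ(aa*) - ψ(a)ψ(a)*` (`norm_map_defect_le`). To conclude that the defect
itself is small, `φ` must be bounded below. An order zero map satisfies `φ x * φ y = φ 1 * φ (x *
y)` (`map_mul_map`), so the part of `F` on which it is of size at most `η` is an ideal, with a
central unit. Removing these ideals by a central projection `p` leaves `φ` bounded below by `η` on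
positive elements of `pF`, while `‖φ (1 - p)‖ ≤ (d + 1) η` (`exists_central_projection_pi`). So `a ↦
p * ψ a` has small defects on the given elements, and the multiplicative domain estimate makes it
almost multiplicative there.

For the trace, `τ ∘ φ` is tracial on `F` because each `φ` restricted to a summand is order zero
(`map_mul_comm_of_trace_pi`). It is almost normalized, and nearly blind to `1 - p`.

The tolerance depends only on `d`, `ε` and a norm bound, and endomorphisms do not increase norms, so
one `δ` serves all orbit lengths `n`. -/

open scoped CStarAlgebra ENNReal

namespace ColouredEntropy

/-! ### Schwarz inequalities and the multiplicative domain. -/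

section CompletelyPositive

variable {A B : Type*} [CStarAlgebra A] [PartialOrder A] [StarOrderedRing A]
  [CStarAlgebra B] [PartialOrder B] [StarOrderedRing B]

/-- The quadratic form of a positive matrix over a C*-algebra is positive. -/
lemma sum_star_mul_mul_nonneg {n : ℕ} {M : CStarMatrix (Fin n) (Fin n) A} (hM : 0 ≤ M)
    (v : Fin n → A) : 0 ≤ ∑ i, ∑ j, star (v i) * M i j * v j := by
  rw [StarOrderedRing.nonneg_iff] at hM
  induction hM using AddSubmonoid.closure_induction with
  | zero => simp
  | add M N _ _ hM hN =>
    simpa only [CStarMatrix.add_apply, mul_add, add_mul, Finset.sum_add_distrib]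
      using add_nonneg hM hN
  | mem M hM =>
    obtain ⟨N, rfl⟩ := hM
    have h : ∑ i, ∑ j, star (v i) * (star N * N) i j * v j
        = ∑ k, star (∑ j, N k j * v j) * (∑ j, N k j * v j) := by
      simp only [CStarMatrix.mul_apply, CStarMatrix.star_apply, star_sum, star_mul,
        Finset.sum_mul, Finset.mul_sum]
      rw [Finset.sum_congr rfl fun i _ => Finset.sum_comm, Finset.sum_comm]
      refine Finset.sum_congr rfl fun k _ => ?_
      rw [Finset.sum_comm]
      simp only [mul_assoc]
    simp only [h]
    exact Finset.sum_nonneg fun k _ => star_mul_self_nonneg _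

/-- The matrix with entries `star (a i) * a j` is `star X * X`, where `X` has `a` as its first row
and zeros elsewhere. -/
lemma _root_.CompletelyPositiveMap.sum_nonneg (φ : A →CP B) {n : ℕ} (a : Fin n → A) (b : Fin n → B) :
    0 ≤ ∑ i, ∑ j, star (b i) * φ (star (a i) * a j) * b j := by
  rcases n with _ | n
  · simp
  let X : CStarMatrix (Fin (n + 1)) (Fin (n + 1)) A :=
    CStarMatrix.ofMatrix (Matrix.of fun i j => if i = 0 then a j else 0)
  have hX : ∀ i j, (star X * X) i j = star (a i) * a j := by
    intro i j
    rw [CStarMatrix.mul_apply, Fin.sum_univ_succ]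
    simp [X, CStarMatrix.star_apply, CStarMatrix.ofMatrix_apply]
  have h := sum_star_mul_mul_nonneg
    (φ.map_cstarMatrix_nonneg (star X * X) (star_mul_self_nonneg X)) b
  simpa only [CStarMatrix.map_apply, hX] using h

/-- The quadratic form of the positive matrix `φ ![![1, x], ![star x, star x * x]]`. -/
lemma _root_.CompletelyPositiveMap.quadratic_nonneg (φ : A →CP B) (x : A) (b c : B) :
    0 ≤ star b * φ 1 * b + star b * φ x * c + (star c * star (φ x) * b
      + star c * φ (star x * x) * c) := by
  have h1 : star (φ 1) = φ 1 := by rw [← map_star, star_one]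
  simpa [Fin.sum_univ_two, map_star, h1] using φ.sum_nonneg ![1, x] ![b, c]

lemma _root_.CompletelyPositiveMap.map_one_le_one {φ : A →CP B} (hφ : IsContractive φ) : φ 1 ≤ 1 := by
  have h0 : (0 : B) ≤ φ 1 := map_nonneg φ zero_le_one
  rw [← CStarAlgebra.norm_le_one_iff_of_nonneg _ h0]
  exact (hφ 1).trans (by nontriviality A; exact CStarRing.norm_one.le)

/-- Kadison's inequality: evaluate the quadratic form at `(-φ x, 1)` and replace `φ 1` by the larger
`1`. -/
lemma _root_.CompletelyPositiveMap.star_map_mul_map_le {φ : A →CP B} (hφ : IsContractive φ) (x : A) :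
    star (φ x) * φ x ≤ φ (star x * x) := by
  have h := φ.quadratic_nonneg x (-φ x) 1
  have h1 := star_left_conjugate_le_conjugate
    (CompletelyPositiveMap.map_one_le_one hφ) (φ x)
  simp only [star_neg, star_one, mul_neg, neg_mul, neg_neg, mul_one, one_mul] at h h1
  rw [← sub_nonneg] at h1 ⊢
  convert add_nonneg h h1 using 1
  abel

/-- An off-diagonal entry of a positive `2 × 2` matrix over a C*-algebra is dominated by the
diagonal entries. -/
lemma norm_sq_le_of_quadratic_nonneg {x y z : B} {C : ℝ} (hC : 0 ≤ C)
    (hz : z ≤ algebraMap ℝ B C)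
    (h : ∀ b c : B, 0 ≤ star b * x * b + star b * y * c
      + (star c * star y * b + star c * z * c)) : ‖y‖ ^ 2 ≤ C * ‖x‖ := by
  -- Test vector `(t, -star y)`, with `z` then replaced by its upper bound `C`.
  have key : ∀ t : ℝ, 0 ≤ (t ^ 2) • x - (2 * t) • (y * star y) + C • (y * star y) := by
    intro t
    have h1 := h (algebraMap ℝ B t) (-star y)
    have h2 := star_right_conjugate_le_conjugate hz y
    rw [← sub_nonneg] at h2
    convert add_nonneg h1 h2 using 1
    simp only [Algebra.algebraMap_eq_smul_one, star_smul, star_trivial, star_one, star_neg,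
      star_star, smul_mul_assoc, mul_smul_comm, one_mul, mul_one, neg_mul, mul_neg, smul_neg,
      neg_neg]
    module
  have key2 : ∀ t : ℝ, C ≤ t → (2 * t - C) * ‖y‖ ^ 2 ≤ t ^ 2 * ‖x‖ := by
    intro t ht
    have h1 : (2 * t - C) • (y * star y) ≤ (t ^ 2) • x := by
      rw [← sub_nonneg]
      convert key t using 1
      module
    have h2 := CStarAlgebra.norm_le_norm_of_nonneg_of_le
      (smul_nonneg (by linarith) (mul_star_self_nonneg y)) h1
    rw [norm_smul, norm_smul, CStarRing.norm_self_mul_star, Real.norm_of_nonneg (by linarith),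
      Real.norm_of_nonneg (by positivity)] at h2
    nlinarith
  -- For `C > 0` the choice `t = C` is enough. For `C = 0` a small `t` forces `y = 0`; the `+ 1` in
  -- its denominator covers `x = 0`.
  rcases hC.eq_or_lt with rfl | hC
  · by_contra! hlt
    have h3 : 0 < ‖y‖ ^ 2 := by simpa using hlt
    have h4 := key2 (‖y‖ ^ 2 / (‖x‖ + 1)) (by positivity)
    have h5 : (‖y‖ ^ 2 / (‖x‖ + 1)) * (‖x‖ + 1) = ‖y‖ ^ 2 := by field_simp
    set t := ‖y‖ ^ 2 / (‖x‖ + 1) with ht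
    have h6 : 0 < t := by positivity
    have h7 : 2 * ‖y‖ ^ 2 ≤ t * ‖x‖ := by
      refine le_of_mul_le_mul_left ?_ h6
      nlinarith
    nlinarith
  · have h4 := key2 C le_rfl
    refine le_of_mul_le_mul_left ?_ hC
    nlinarith

/-- The multiplicative domain estimate. -/
lemma _root_.CompletelyPositiveMap.norm_map_mul_sub_sq_le {φ : A →CP B} (hφ : IsContractive φ) (a b : A) :
    ‖φ (a * b) - φ a * φ b‖ ^ 2
      ≤ ‖b‖ ^ 2 * ‖φ (a * star a) - φ a * star (φ a)‖ := by
  refine norm_sq_le_of_quadratic_nonneg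
    (z := φ (star b * b) - star (φ b) * φ b) (by positivity) ?_ ?_
  · have h1 : φ (star b * b) ≤ algebraMap ℝ B (‖b‖ ^ 2) := by
      have h2 : (star b * b : A) ≤ algebraMap ℝ A (‖b‖ ^ 2) := by
        have := (IsSelfAdjoint.star_mul_self b).le_algebraMap_norm_self
        rwa [CStarRing.norm_star_mul_self, ← sq] at this
      have h3 := OrderHomClass.mono φ h2
      refine h3.trans ?_
      rw [Algebra.algebraMap_eq_smul_one, Algebra.algebraMap_eq_smul_one,
        LinearMapClass.map_smul_of_tower φ]
      exact smul_le_smul_of_nonneg_left (CompletelyPositiveMap.map_one_le_one hφ) (by positivity)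
    exact (sub_le_self _ (star_mul_self_nonneg _)).trans h1
  · intro u v
    have e1 : star (φ 1) = φ 1 := by rw [← map_star, star_one]
    have e2 : star (φ (a * star a)) = φ (a * star a) := by
      rw [← map_star, star_mul, star_star]
    -- A Schur complement: in the `3 × 3` form of `1, star a, b`, the first coefficient `-w`
    -- completes the square and leaves the `2 × 2` matrix of multiplicative defects.
    set w := star (φ a) * u + φ b * v with hw
    have hw' : star w = star u * φ a + star v * star (φ b) := by
      simp only [hw, star_add, star_mul, star_star]
    have h := φ.sum_nonneg ![1, star a, b] ![-w, u, v]
    have h1 := star_left_conjugate_le_conjugate (CompletelyPositiveMap.map_one_le_one hφ) w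
    rw [← sub_nonneg] at h1
    simp only [Fin.sum_univ_succ, Fin.sum_univ_zero, Matrix.cons_val_zero, Matrix.cons_val_succ,
      star_one, one_mul, mul_one, star_star, ← star_mul] at h
    simp only [map_star, e2, star_neg, mul_one] at h h1
    convert add_nonneg h h1 using 1
    rw [hw']
    simp only [hw, star_sub, star_mul]
    noncomm_ring

end CompletelyPositive

/-! ### Spectral projections and units of ideals in finite dimension. -/

section SpectralProjection

variable {F : Type*} [CStarAlgebra F]

/-- The spectral projection of a self-adjoint element at a real number. -/
noncomputable def spectralProjection (x : F) (l : ℝ) : F :=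
  cfc (fun t : ℝ => if t = l then 1 else 0) x

lemma spectralProjection_nonneg [PartialOrder F] [StarOrderedRing F] (x : F) (l : ℝ) :
    0 ≤ spectralProjection x l :=
  cfc_nonneg fun t _ => by positivity

variable [FiniteDimensional ℂ F]

lemma finite_spectrum_real (a : F) : (spectrum ℝ a).Finite := by
  nontriviality F
  have : FiniteDimensional ℝ F := FiniteDimensional.trans ℝ ℂ F
  have hint : IsIntegral ℝ a := Algebra.IsIntegral.isIntegral a
  refine ((minpoly ℝ a).roots.toFinset.finite_toSet).subset fun μ hμ => ?_
  have h := spectrum.subset_polynomial_aeval a (minpoly ℝ a) ⟨μ, hμ, rfl⟩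
  rw [minpoly.aeval, spectrum.zero_eq] at h
  simpa [minpoly.ne_zero hint] using h

/-- Finiteness of the spectrum admits discontinuous functions, such as indicators of points, into
the continuous functional calculus. -/
lemma continuousOn_spectrum (f : ℝ → ℝ) (a : F) : ContinuousOn f (spectrum ℝ a) :=
  (finite_spectrum_real a).continuousOn f

lemma spectralProjection_mul_self (x : F) (l : ℝ) :
    spectralProjection x l * spectralProjection x l = spectralProjection x l := by
  rw [spectralProjection, ← cfc_mul _ _ x (continuousOn_spectrum _ x) (continuousOn_spectrum _ x)]
  refine cfc_congr fun t _ => ?_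
  by_cases h1 : t = l <;> simp [h1]

lemma spectralProjection_mul_of_ne (x : F) {l m : ℝ} (h : l ≠ m) :
    spectralProjection x l * spectralProjection x m = 0 := by
  rw [spectralProjection, spectralProjection,
    ← cfc_mul _ _ x (continuousOn_spectrum _ x) (continuousOn_spectrum _ x)]
  refine (cfc_congr fun t _ => ?_).trans (cfc_zero ℝ x)
  by_cases h1 : t = l
  · simp [h1, h]
  · simp [h1]

lemma spectralProjection_mul_right {x : F} (hx : IsSelfAdjoint x) (l : ℝ) :
    spectralProjection x l * x = l • spectralProjection x l := by
  conv_lhs => rw [spectralProjection]; arg 2; rw [← cfc_id' ℝ x]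
  rw [← cfc_mul _ _ x (continuousOn_spectrum _ x) (continuousOn_spectrum _ x),
    spectralProjection, ← cfc_smul l _ x (continuousOn_spectrum _ x)]
  refine cfc_congr fun t _ => ?_
  by_cases h1 : t = l <;> simp [h1]

lemma sum_spectralProjection {x : F} (hx : IsSelfAdjoint x) :
    ∑ l ∈ (finite_spectrum_real x).toFinset, spectralProjection x l = 1 := by
  simp only [spectralProjection]
  rw [← cfc_sum _ _ _ fun _ _ => continuousOn_spectrum _ x, ← cfc_one ℝ x]
  refine cfc_congr fun t ht => ?_
  simp [ht]

lemma sum_smul_spectralProjection {x : F} (hx : IsSelfAdjoint x) :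
    ∑ l ∈ (finite_spectrum_real x).toFinset, l • spectralProjection x l = x := by
  conv_rhs => rw [← one_mul x, ← sum_spectralProjection hx, Finset.sum_mul]
  exact Finset.sum_congr rfl fun l _ => (spectralProjection_mul_right hx l).symm

variable [PartialOrder F] [StarOrderedRing F]

lemma smul_spectralProjection_le {x : F} (hx : 0 ≤ x) (l : ℝ) :
    l • spectralProjection x l ≤ x := by
  conv_rhs => rw [← cfc_id' ℝ x]
  rw [spectralProjection, ← cfc_smul l _ x (continuousOn_spectrum _ x)]
  refine cfc_mono (fun t ht => ?_) (continuousOn_spectrum _ x) (continuousOn_spectrum _ x)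
  have := spectrum_nonneg_of_nonneg hx ht
  by_cases h1 : t = l
  · simp [h1]
  · simpa [h1] using this

lemma spectralProjection_norm_ne_zero {x : F} (hx : 0 ≤ x) (hx0 : x ≠ 0) :
    spectralProjection x ‖x‖ ≠ 0 := by
  have : Nontrivial F := ⟨x, 0, hx0⟩
  have hmem : ‖x‖ ∈ spectrum ℝ x := CStarAlgebra.norm_mem_spectrum_of_nonneg hx
  intro h
  have h1 : (1 : ℝ) ∈ spectrum ℝ (spectralProjection x ‖x‖) := by
    rw [spectralProjection, cfc_map_spectrum _ x (hf := continuousOn_spectrum _ x)]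
    exact ⟨‖x‖, hmem, by simp⟩
  simp [h] at h1

/-- A self-adjoint two-sided ideal of a finite-dimensional C*-algebra has a unit. -/
lemma exists_unit_of_ideal (I : Submodule ℂ F) (hl : ∀ x y, y ∈ I → x * y ∈ I)
    (hr : ∀ x y, y ∈ I → y * x ∈ I) (hs : ∀ y ∈ I, star y ∈ I) :
    ∃ e ∈ I, IsSelfAdjoint e ∧ (∀ y ∈ I, y * e = y) ∧ (∀ y ∈ I, e * y = y) := by
  obtain ⟨s, hspan⟩ := (IsNoetherian.noetherian I : I.FG)
  have hmem : ∀ b ∈ s, b ∈ I := fun b hb => hspan ▸ Submodule.subset_span hb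
  set x := ∑ b ∈ s, star b * b with hx
  have hx0 : 0 ≤ x := Finset.sum_nonneg fun b _ => star_mul_self_nonneg b
  have hxI : x ∈ I := I.sum_mem fun b hb => hl _ _ (hmem b hb)
  -- As `0⁻¹ = 0`, the function is the indicator of `t ≠ 0`, so `e` is the support projection of
  -- `x`; its factor `x` keeps it in `I`.
  set e := cfc (fun t : ℝ => t * t⁻¹) x with he
  have hesa : IsSelfAdjoint e := cfc_predicate _ x
  have hxe : x * e = x := by
    conv_lhs => rw [he]; arg 1; rw [← cfc_id' ℝ x]
    rw [← cfc_mul _ _ x (continuousOn_spectrum _ x) (continuousOn_spectrum _ x)]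
    conv_rhs => rw [← cfc_id' ℝ x]
    refine cfc_congr fun t _ => ?_
    by_cases ht : t = 0 <;> simp [ht]
  have heI : e ∈ I := by
    rw [he, cfc_mul _ _ x (continuousOn_spectrum _ x) (continuousOn_spectrum _ x), cfc_id' ℝ x]
    exact hr _ _ hxI
  have hb : ∀ b ∈ s, b * e = b := by
    intro b hb
    have h1 : star b * b ≤ x :=
      Finset.single_le_sum (f := fun b => star b * b) (fun b _ => star_mul_self_nonneg b) hb
    -- Compression by `1 - e` kills `x`, hence also the smaller `star b * b`.
    have h2 := star_left_conjugate_le_conjugate h1 (1 - e)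
    have h3 : star (1 - e) * x * (1 - e) = 0 := by
      rw [mul_assoc, mul_sub, mul_one, hxe, sub_self, mul_zero]
    have h4 : star (1 - e) * (star b * b) * (1 - e) = star (b * (1 - e)) * (b * (1 - e)) := by
      simp only [star_mul, mul_assoc]
    rw [h3, h4] at h2
    have h5 := (CStarRing.star_mul_self_eq_zero_iff _).mp
      (le_antisymm h2 (star_mul_self_nonneg _))
    rw [mul_sub, mul_one, sub_eq_zero] at h5
    exact h5.symm
  have hright : ∀ y ∈ I, y * e = y := by
    intro y hy
    rw [← hspan] at hy
    induction hy using Submodule.span_induction with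
    | mem y hy => exact hb y hy
    | zero => simp
    | add y z _ _ hy hz => rw [add_mul, hy, hz]
    | smul c y _ hy => rw [smul_mul_assoc, hy]
  refine ⟨e, heI, hesa, hright, fun y hy => ?_⟩
  have := congrArg star (hright _ (hs y hy))
  simpa [hesa.star_eq] using this

end SpectralProjection

/-! ### Multiplicative structure of order zero maps. -/

section OrderZero

variable {F A : Type*} [CStarAlgebra F] [PartialOrder F] [StarOrderedRing F]
  [FiniteDimensional ℂ F] [CStarAlgebra A] [PartialOrder A] [StarOrderedRing A]

namespace IsOrderZero

variable {φ : F →CP A}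

/-- Distinct spectral projections of `x` have orthogonal images, so products of `φ 1`, `φ x` and `φ
(x * x)` are computed diagonally. -/
lemma map_one_mul_of_isSelfAdjoint (hφ : IsOrderZero φ) {x : F} (hx : IsSelfAdjoint x) :
    φ 1 * φ x = φ x * φ 1 ∧ φ x * φ x = φ 1 * φ (x * x) := by
  set s := (finite_spectrum_real x).toFinset
  set p := spectralProjection x
  have horth : ∀ l m, l ≠ m → φ (p l) * φ (p m) = 0 := fun l m hlm =>
    hφ _ _ (spectralProjection_nonneg x l) (spectralProjection_nonneg x m)
      (spectralProjection_mul_of_ne x hlm)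
  have h1 : φ 1 = ∑ l ∈ s, φ (p l) := by rw [← map_sum, sum_spectralProjection hx]
  have hsum : ∀ f : ℝ → ℝ, φ (∑ l ∈ s, f l • p l) = ∑ l ∈ s, f l • φ (p l) := fun f => by
    simp only [map_sum, LinearMapClass.map_smul_of_tower φ]
  have hmul : ∀ f g : ℝ → ℝ, (∑ l ∈ s, f l • φ (p l)) * (∑ l ∈ s, g l • φ (p l))
      = ∑ l ∈ s, (f l * g l) • (φ (p l) * φ (p l)) := by
    intro f g
    rw [Finset.sum_mul_sum]
    refine Finset.sum_congr rfl fun l hl => ?_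
    rw [Finset.sum_eq_single l]
    · rw [smul_mul_smul_comm]
    · intro m _ hm
      rw [smul_mul_smul_comm, horth l m hm.symm, smul_zero]
    · exact fun h => absurd hl h
  have hx1 : φ x = ∑ l ∈ s, l • φ (p l) := by
    conv_lhs => rw [← sum_smul_spectralProjection hx]
    exact hsum fun l => l
  have hx2 : φ (x * x) = ∑ l ∈ s, (l * l) • φ (p l) := by
    rw [← hsum fun l => l * l]
    congr 1
    conv_lhs => arg 1; rw [← sum_smul_spectralProjection hx]
    rw [Finset.sum_mul]
    refine Finset.sum_congr rfl fun l _ => ?_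
    rw [smul_mul_assoc, spectralProjection_mul_right hx, smul_smul]
  have h1' : φ 1 = ∑ l ∈ s, (1 : ℝ) • φ (p l) := by simpa using h1
  constructor
  · rw [hx1, h1', hmul, hmul]
    simp only [mul_comm]
  · rw [hx1, h1', hx2, hmul, hmul]
    simp only [one_mul]

lemma map_one_mul_comm (hφ : IsOrderZero φ) (x : F) : φ 1 * φ x = φ x * φ 1 := by
  rw [← realPart_add_I_smul_imaginaryPart x, map_add, map_smul, mul_add, add_mul,
    (hφ.map_one_mul_of_isSelfAdjoint (realPart x).2).1, mul_smul_comm, smul_mul_assoc,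
    (hφ.map_one_mul_of_isSelfAdjoint (imaginaryPart x).2).1]

/-- In the symmetrized product the cross terms of real and imaginary parts cancel, leaving squares
of self-adjoint elements. -/
lemma star_mul_add_mul_star (hφ : IsOrderZero φ) (x : F) :
    star (φ x) * φ x + φ x * star (φ x) = φ 1 * φ (star x * x + x * star x) := by
  set a : F := (realPart x : F) with ha
  set b : F := (imaginaryPart x : F) with hb
  have hx : x = a + Complex.I • b := (realPart_add_I_smul_imaginaryPart x).symm
  have hsa : star a = a := (realPart x).2
  have hsb : star b = b := (imaginaryPart x).2
  have h1 := (hφ.map_one_mul_of_isSelfAdjoint (realPart x).2).2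
  have h2 := (hφ.map_one_mul_of_isSelfAdjoint (imaginaryPart x).2).2
  have hfa : star (φ a) = φ a := by rw [← map_star, hsa]
  have hfb : star (φ b) = φ b := by rw [← map_star, hsb]
  have hI : Complex.I * Complex.I = -1 := Complex.I_mul_I
  have e1 : star x * x + x * star x = (2 : ℂ) • (a * a) + (2 : ℂ) • (b * b) := by
    rw [hx]
    simp only [star_add, star_smul, hsa, hsb, mul_add, add_mul, smul_mul_assoc, mul_smul_comm,
      smul_smul, smul_add, Complex.star_def, Complex.conj_I, neg_mul, mul_neg, hI]
    module
  have e2 : star (φ x) * φ x + φ x * star (φ x)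
      = (2 : ℂ) • (φ a * φ a) + (2 : ℂ) • (φ b * φ b) := by
    rw [hx, map_add, map_smul]
    simp only [star_add, star_smul, hfa, hfb, mul_add, add_mul, smul_mul_assoc, mul_smul_comm,
      smul_smul, smul_add, Complex.star_def, Complex.conj_I, neg_mul, mul_neg, hI]
    module
  rw [e1, e2, h1, h2, map_add, map_smul, map_smul, mul_add, mul_smul_comm, mul_smul_comm]

/-- The quadratic form at `(-φ x, φ 1)`, rearranged using that `φ 1` commutes with the range. -/
lemma map_one_mul_defect_nonneg (hφ : IsOrderZero φ) (x : F) :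
    0 ≤ φ 1 * (φ 1 * φ (star x * x) - star (φ x) * φ x) := by
  have h := φ.quadratic_nonneg x (-φ x) (φ 1)
  have e1 : star (φ 1) = φ 1 := by rw [← map_star, star_one]
  have c1 := hφ.map_one_mul_comm x
  have c2 := hφ.map_one_mul_comm (star x * x)
  have c3 : φ 1 * star (φ x) = star (φ x) * φ 1 := by
    rw [← map_star]; exact hφ.map_one_mul_comm _
  convert h using 1
  simp only [e1, star_neg, neg_mul, mul_neg, neg_neg, mul_sub]
  rw [mul_assoc (φ 1) (φ (star x * x)), ← c2]
  have k1 : star (φ x) * φ 1 * φ x = φ 1 * (star (φ x) * φ x) := by rw [← c3, mul_assoc]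
  have k2 : star (φ x) * φ x * φ 1 = φ 1 * (star (φ x) * φ x) := by
    rw [mul_assoc, ← c1, ← mul_assoc, ← c3, mul_assoc]
  rw [k1, k2, mul_assoc (φ 1) (star (φ x))]
  abel

/-- The support of a completely positive map is controlled by its value at the unit. -/
lemma _root_.CompletelyPositiveMap.mul_map_eq_zero {A B : Type*} [CStarAlgebra A] [PartialOrder A]
    [StarOrderedRing A] [CStarAlgebra B] [PartialOrder B] [StarOrderedRing B] (φ : A →CP B)
    {d : B} (hd : d * φ 1 = 0) (x : A) : d * φ x = 0 := by
  obtain ⟨C, hC0, hC⟩ : ∃ C : ℝ, 0 ≤ C ∧ φ (star x * x) ≤ algebraMap ℝ B C :=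
    ⟨_, norm_nonneg _, IsSelfAdjoint.le_algebraMap_norm_self
      (IsSelfAdjoint.of_nonneg (map_nonneg φ (star_mul_self_nonneg x)))⟩
  have hd' : φ 1 * star d = 0 := by
    have := congrArg star hd
    rwa [star_mul, ← map_star, star_one, star_zero] at this
  have h := norm_sq_le_of_quadratic_nonneg (x := d * φ 1 * star d) (y := d * φ x)
    (z := φ (star x * x)) hC0 hC (fun b c => by
      convert φ.quadratic_nonneg x (star d * b) c using 1
      simp only [star_mul, star_star, mul_assoc])
  rw [hd, zero_mul, norm_zero, mul_zero] at h
  exact norm_eq_zero.mp (pow_eq_zero_iff two_ne_zero |>.mp (le_antisymm h (by positivity)))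

/-- By the symmetrized identity the defect for `star x` is `-D`. Both `φ 1 * D` and its negative are
positive, so `φ 1 * D = 0`; then `D` annihilates the range of `φ`, and `D * D = 0`. -/
lemma star_map_mul_map_self (hφ : IsOrderZero φ) (x : F) :
    star (φ x) * φ x = φ 1 * φ (star x * x) := by
  set D := φ 1 * φ (star x * x) - star (φ x) * φ x with hD
  have h1 := hφ.map_one_mul_defect_nonneg x
  have h2 := hφ.map_one_mul_defect_nonneg (star x)
  have h3 := hφ.star_mul_add_mul_star x
  rw [map_star, star_star, star_star] at h2
  have h4 : φ 1 * φ (x * star x) - φ x * star (φ x) = -D := by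
    rw [map_add, mul_add] at h3
    rw [hD, neg_sub, sub_eq_sub_iff_add_eq_add, add_comm, ← h3, add_comm]
  rw [h4, mul_neg, neg_nonneg] at h2
  have h5 : φ 1 * D = 0 := le_antisymm h2 h1
  have hDs : star D = D := by
    rw [hD, star_sub, star_mul, star_mul, star_star, ← map_star, ← map_star, star_mul, star_star,
      star_one, ← hφ.map_one_mul_comm]
  have h6 : D * φ 1 = 0 := by
    have := congrArg star h5
    rwa [star_mul, hDs, ← map_star, star_one, star_zero] at this
  have h7 : D * D = 0 := by
    conv_lhs => arg 2; rw [hD]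
    rw [mul_sub, ← mul_assoc, h6, zero_mul, ← mul_assoc, ← map_star,
      φ.mul_map_eq_zero h6, zero_mul, sub_zero]
  have h8 : D = 0 := by
    rw [← CStarRing.star_mul_self_eq_zero_iff, hDs, h7]
  rw [hD, sub_eq_zero] at h8
  exact h8.symm

/-- Order zero maps on finite-dimensional C*-algebras are multiplicative up to the factor
`φ 1`. -/
lemma map_mul_map (hφ : IsOrderZero φ) (x y : F) : φ x * φ y = φ 1 * φ (x * y) := by
  suffices h : ∀ x y : F, star (φ x) * φ y = φ 1 * φ (star x * y) by
    simpa [map_star] using h (star x) y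
  intro x y
  -- Polarization: `x + y` gives the sum of the two cross terms, `x + i y` their difference.
  have h1 := hφ.star_map_mul_map_self (x + y)
  have h2 := hφ.star_map_mul_map_self (x + Complex.I • y)
  have hx := hφ.star_map_mul_map_self x
  have hy := hφ.star_map_mul_map_self y
  simp only [map_add, map_smul, star_add, star_smul, mul_add, add_mul, smul_mul_assoc,
    mul_smul_comm, smul_add, Complex.star_def, Complex.conj_I, neg_mul, mul_neg, neg_smul,
    map_neg, hx, hy] at h1 h2
  set a := star (φ x) * φ y
  set b := star (φ y) * φ x
  set a' := φ 1 * φ (star x * y)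
  set b' := φ 1 * φ (star y * x)
  have k1 : a + b = a' + b' := by
    rw [← sub_eq_zero] at h1 ⊢
    rw [← h1]; abel
  have k2 : Complex.I • a - Complex.I • b = Complex.I • a' - Complex.I • b' := by
    rw [← sub_eq_zero] at h2 ⊢
    rw [← h2]; abel
  rw [← smul_sub, ← smul_sub] at k2
  have k3 := smul_right_injective A Complex.I_ne_zero k2
  have k4 : (2 : ℂ) • a = (2 : ℂ) • a' := by
    have : (a + b) + (a - b) = (a' + b') + (a' - b') := by rw [k1]; exact congrArg _ k3
    rw [two_smul, two_smul]
    simpa using this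
  exact smul_right_injective A two_ne_zero k4

end IsOrderZero

end OrderZero

/-- On `[0, 1]`, Bernoulli gives `(1 - t)^n (1 + n t) ≤ (1 - t²)^n ≤ 1`, and `(n + 1) t ≤ 1 + n t`.
-/
lemma norm_one_sub_pow_mul_self_le {A : Type*} [CStarAlgebra A] [PartialOrder A]
    [StarOrderedRing A] {h : A} (h0 : 0 ≤ h) (h1 : h ≤ 1) (n : ℕ) :
    ‖(1 - h) ^ n * h‖ ≤ 1 / (n + 1) := by
  have hcfc : (1 - h) ^ n * h = cfc (fun t : ℝ => (1 - t) ^ n * t) h := by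
    rw [cfc_mul (fun t : ℝ => (1 - t) ^ n) (fun t : ℝ => t) h, cfc_pow (fun t : ℝ => 1 - t) n h,
      cfc_sub (fun _ : ℝ => 1) (fun t : ℝ => t) h, cfc_const_one ℝ h, cfc_id' ℝ h]
  rw [hcfc]
  refine norm_cfc_le (by positivity) fun t ht => ?_
  have ht0 : 0 ≤ t := spectrum_nonneg_of_nonneg h0 ht
  have ht1 : t ≤ 1 := by
    have h1' : h ≤ algebraMap ℝ A 1 := by simpa using h1
    exact (le_algebraMap_iff_spectrum_le (IsSelfAdjoint.of_nonneg h0)).mp h1' t ht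
  have hpow : 0 ≤ (1 - t) ^ n := pow_nonneg (by linarith) n
  rw [Real.norm_of_nonneg (by positivity), le_div_iff₀ (by positivity)]
  have hB : 1 + (n : ℝ) * t ≤ (1 + t) ^ n := one_add_mul_le_pow (by linarith) n
  have hle : (1 - t) ^ n * (1 + t) ^ n ≤ 1 := by
    rw [← mul_pow]
    exact pow_le_one₀ (by nlinarith) (by nlinarith)
  nlinarith [mul_le_mul_of_nonneg_left hB hpow]

/-! ### Traces through order zero maps, and cutting off where the map is small. -/

section OrderZero

variable {F A : Type*} [CStarAlgebra F] [PartialOrder F] [StarOrderedRing F]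
  [CStarAlgebra A] [PartialOrder A] [StarOrderedRing A]

namespace IsOrderZero

variable {φ : F →CP A}

/-- The ideal of those elements on which, after dividing by `φ 1`, the map `φ` is supported where
`φ 1` is at most `η`. -/
def smallIdeal (φ : F →CP A) (η : ℝ) : Submodule ℂ F where
  carrier := {x | ∃ C : ℝ, ∀ n : ℕ, ‖φ 1 ^ n * φ x‖ ≤ C * η ^ n}
  zero_mem' := ⟨0, fun n => by simp⟩
  add_mem' := by
    rintro x y ⟨C, hC⟩ ⟨D, hD⟩
    refine ⟨C + D, fun n => ?_⟩
    rw [map_add, mul_add, add_mul]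
    exact (norm_add_le _ _).trans (add_le_add (hC n) (hD n))
  smul_mem' := by
    rintro c x ⟨C, hC⟩
    refine ⟨‖c‖ * C, fun n => ?_⟩
    rw [map_smul, mul_smul_comm, norm_smul, mul_assoc]
    exact mul_le_mul_of_nonneg_left (hC n) (norm_nonneg c)

/-- One spare factor `φ 1` is harmless; it is what turns `φ (y * x)` into `φ y * φ x` in the ideal
property. -/
lemma mem_smallIdeal_of_bound {η : ℝ} (hη : 0 < η) {x : F} {C : ℝ}
    (h : ∀ n : ℕ, ‖φ 1 ^ (n + 1) * φ x‖ ≤ C * η ^ n) : x ∈ smallIdeal φ η := by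
  refine ⟨max ‖φ x‖ (C / η), fun n => ?_⟩
  rcases n with _ | n
  · simp
  · refine (h n).trans ?_
    calc C * η ^ n = C / η * η ^ (n + 1) := by field_simp; ring
      _ ≤ _ := by gcongr; exact le_max_right _ _

variable [FiniteDimensional ℂ F]

/-- The C*-identity and `map_mul_map` reduce the squared norm to that of `(1 - φ 1)^(2n) * φ 1 * φ
(x * star x)`, which decays like `1 / n`. -/
lemma tendsto_one_sub_pow_mul_map (hφ : IsOrderZero φ) (hc : IsContractive φ) (x : F) :
    Filter.Tendsto (fun n : ℕ => (1 - φ 1) ^ n * φ x) Filter.atTop (nhds 0) := by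
  have h0 : 0 ≤ φ 1 := map_nonneg φ zero_le_one
  have h1 : φ 1 ≤ 1 := CompletelyPositiveMap.map_one_le_one hc
  have hsa : star (φ 1) = φ 1 := by rw [← map_star, star_one]
  have hcomm : ∀ (n : ℕ) y, Commute ((1 - φ 1) ^ n) (φ y) := fun n y =>
    ((Commute.one_left _).sub_left (hφ.map_one_mul_comm y)).pow_left n
  have hb : ∀ n : ℕ, ‖(1 - φ 1) ^ n * φ x‖ ≤ √(‖x‖ ^ 2 * (1 / ((n : ℝ) + 1))) := by
    intro n
    refine Real.le_sqrt_of_sq_le ?_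
    have e1 : (1 - φ 1) ^ n * φ x * star ((1 - φ 1) ^ n * φ x)
        = ((1 - φ 1) ^ (n + n) * φ 1) * φ (x * star x) := by
      rw [star_mul, star_pow, star_sub, star_one, hsa, ← mul_assoc, mul_assoc _ (φ x),
        ← map_star, hφ.map_mul_map, mul_assoc, mul_assoc, ← (hcomm n _).eq, ← mul_assoc (φ 1),
        ← (hcomm n 1).eq, pow_add]
      simp only [mul_assoc]
    rw [sq, ← CStarRing.norm_self_mul_star, e1]
    refine (norm_mul_le _ _).trans ?_
    have e2 := norm_one_sub_pow_mul_self_le h0 h1 (n + n)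
    have e3 : ‖φ (x * star x)‖ ≤ ‖x‖ ^ 2 := by
      simpa [CStarRing.norm_self_mul_star, sq] using hc (x * star x)
    have e4 : (1 : ℝ) / ((n + n : ℕ) + 1) ≤ 1 / (n + 1) := by
      gcongr; linarith [(Nat.cast_nonneg n : (0 : ℝ) ≤ n)]
    rw [mul_comm (‖x‖ ^ 2)]
    exact mul_le_mul (e2.trans e4) e3 (norm_nonneg _) (by positivity)
  refine squeeze_zero_norm hb ?_
  have := ((tendsto_one_div_add_atTop_nhds_zero_nat (𝕜 := ℝ)).const_mul (‖x‖ ^ 2)).sqrt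
  simpa using this

open scoped ComplexOrder in
-- Traciality is immediate for commutators weighted by a factor `φ 1`. Thus inserting `(1 - φ 1)^n`
-- does not change the value of `f` on the image of a commutator, and as `n → ∞` that value is `0`.
lemma map_mul_comm_of_trace (hφ : IsOrderZero φ) (hc : IsContractive φ) (f : A →ₚ[ℂ] ℂ)
    (hf : ∀ a b, f (a * b) = f (b * a)) (x y : F) : f (φ (x * y)) = f (φ (y * x)) := by
  have hcomm : ∀ n : ℕ, ∀ y, (1 - φ 1) ^ n * φ y = φ y * (1 - φ 1) ^ n := fun n y =>
    (((Commute.one_left _).sub_left (hφ.map_one_mul_comm y)).pow_left n).eq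
  have h1 : ∀ n : ℕ, f ((1 - φ 1) ^ n * φ 1 * φ (x * y - y * x)) = 0 := by
    intro n
    rw [mul_assoc, map_sub, mul_sub, ← hφ.map_mul_map, ← hφ.map_mul_map, mul_sub, map_sub,
      ← mul_assoc, hf, ← mul_assoc (φ y), ← hcomm, mul_assoc, sub_self]
  have h2 : ∀ n : ℕ, f ((1 - φ 1) ^ n * φ (x * y - y * x)) = f (φ (x * y - y * x)) := by
    intro n
    induction n with
    | zero => simp
    | succ n ih => rw [pow_succ, mul_sub, sub_mul, map_sub, h1, mul_one, sub_zero, ih]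
  obtain ⟨C, hC⟩ := f.exists_norm_apply_le
  have h3 : Filter.Tendsto (fun n : ℕ => f ((1 - φ 1) ^ n * φ (x * y - y * x)))
      Filter.atTop (nhds 0) := by
    refine squeeze_zero_norm (fun n => hC _) ?_
    simpa using (hφ.tendsto_one_sub_pow_mul_map hc (x * y - y * x)).norm.const_mul (C : ℝ)
  simp only [h2] at h3
  have h4 := tendsto_nhds_unique tendsto_const_nhds h3
  rwa [map_sub, map_sub, sub_eq_zero] at h4

lemma map_one_pow_mul_map (hφ : IsOrderZero φ) {q : F} (hq : q * q = q) (n : ℕ) :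
    φ 1 ^ n * φ q = φ q ^ (n + 1) := by
  induction n with
  | zero => simp
  | succ n ih =>
    rw [pow_succ, mul_assoc, ← hq, ← hφ.map_mul_map, hq, ← mul_assoc, ih, pow_succ (φ q) (n + 1)]

lemma mul_mem_smallIdeal_right (hφ : IsOrderZero φ) {η : ℝ} (hη : 0 < η) (x : F) {y : F}
    (hy : y ∈ smallIdeal φ η) : y * x ∈ smallIdeal φ η := by
  obtain ⟨C, hC⟩ := hy
  refine mem_smallIdeal_of_bound hη (C := C * ‖φ x‖) fun n => ?_
  rw [pow_succ, mul_assoc, ← hφ.map_mul_map, ← mul_assoc, mul_right_comm]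
  exact (norm_mul_le _ _).trans (mul_le_mul_of_nonneg_right (hC n) (norm_nonneg _))

lemma star_mem_smallIdeal (hφ : IsOrderZero φ) {η : ℝ} {y : F}
    (hy : y ∈ smallIdeal φ η) : star y ∈ smallIdeal φ η := by
  obtain ⟨C, hC⟩ := hy
  refine ⟨C, fun n => ?_⟩
  have hcomm : Commute (φ 1 ^ n) (φ y) :=
    Commute.pow_left (hφ.map_one_mul_comm y) n
  have : φ 1 ^ n * φ (star y) = star (φ 1 ^ n * φ y) := by
    rw [hcomm.eq, star_mul, star_pow, ← map_star, ← map_star, star_one]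
  rw [this, norm_star]
  exact hC n

lemma mul_mem_smallIdeal_left (hφ : IsOrderZero φ) {η : ℝ} (hη : 0 < η) (x : F) {y : F}
    (hy : y ∈ smallIdeal φ η) : x * y ∈ smallIdeal φ η := by
  have := hφ.star_mem_smallIdeal
    (hφ.mul_mem_smallIdeal_right hη (star x) (hφ.star_mem_smallIdeal hy))
  simpa using this

/-- A projection belongs to the ideal exactly when its image has norm at most `η`. -/
lemma mem_smallIdeal_iff (hφ : IsOrderZero φ) {η : ℝ} (hη : 0 < η) {q : F} (hq : q * q = q)
    (hq' : IsSelfAdjoint q) : q ∈ smallIdeal φ η ↔ ‖φ q‖ ≤ η := by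
  constructor
  · rintro ⟨C, hC⟩
    by_contra! hlt
    have hsa : IsSelfAdjoint (φ q) := hq'.map φ
    -- For a projection the defining bound concerns powers of `φ q`; exponents `2 ^ k` are used
    -- because there the norm of a self-adjoint element is multiplicative.
    have hb : ∀ k : ℕ, (‖φ q‖ / η) ^ (2 ^ k) ≤ C / η := by
      intro k
      obtain ⟨m, hm⟩ : ∃ m, 2 ^ k = m + 1 := ⟨2 ^ k - 1, by have := Nat.one_le_two_pow (n := k); omega⟩
      have h1 := hC m
      rw [hφ.map_one_pow_mul_map hq, ← hm] at h1
      have h2 : ‖φ q ^ (2 ^ k)‖ = ‖φ q‖ ^ (2 ^ k) := by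
        simpa [← NNReal.coe_inj] using hsa.nnnorm_pow_two_pow k
      rw [h2] at h1
      rw [div_pow, div_le_div_iff₀ (by positivity) hη]
      calc ‖φ q‖ ^ (2 ^ k) * η ≤ C * η ^ m * η := by gcongr
        _ = C * η ^ (2 ^ k) := by rw [hm]; ring
    have hgt : 1 < ‖φ q‖ / η := by rwa [one_lt_div hη]
    obtain ⟨n, hn⟩ := pow_unbounded_of_one_lt (C / η) hgt
    have h3 := pow_le_pow_right₀ hgt.le (Nat.lt_two_pow_self (n := n)).le
    linarith [hb n]
  · intro h
    refine ⟨η, fun n => ?_⟩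
    rw [hφ.map_one_pow_mul_map hq, ← pow_succ']
    exact (norm_pow_le' _ n.succ_pos).trans (by gcongr)

/-- A central projection cutting off the part of `F` on which the order zero map `φ` is small. -/
lemma exists_central_projection (hφ : IsOrderZero φ) {η : ℝ} (hη : 0 < η) :
    ∃ p : F, IsSelfAdjoint p ∧ p * p = p ∧ (∀ x, p * x = x * p) ∧ ‖φ (1 - p)‖ ≤ η ∧
      ∀ x, 0 ≤ x → η * ‖p * x‖ ≤ ‖φ (p * x)‖ := by
  obtain ⟨e, heI, hesa, hright, hleft⟩ := exists_unit_of_ideal (smallIdeal φ η)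
    (fun x y hy => hφ.mul_mem_smallIdeal_left hη x hy)
    (fun x y hy => hφ.mul_mem_smallIdeal_right hη x hy)
    (fun y hy => hφ.star_mem_smallIdeal hy)
  have hee : e * e = e := hright e heI
  have hcen : ∀ x, e * x = x * e := fun x => by
    rw [← hright _ (hφ.mul_mem_smallIdeal_right hη x heI),
      mul_assoc, hleft _ (hφ.mul_mem_smallIdeal_left hη x heI)]
  have hpp : (1 - e) * (1 - e) = 1 - e := by
    rw [mul_sub, sub_mul, sub_mul, hee]; simp
  have hpc : ∀ x, (1 - e) * x = x * (1 - e) := fun x => by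
    rw [sub_mul, mul_sub, hcen, one_mul, mul_one]
  have hpsa : IsSelfAdjoint (1 - e) := (IsSelfAdjoint.one F).sub hesa
  refine ⟨1 - e, hpsa, hpp, hpc, ?_, fun x hx => ?_⟩
  · rw [sub_sub_cancel]
    exact (hφ.mem_smallIdeal_iff hη hee hesa).mp heI
  · set y := (1 - e) * x with hy
    have hyp : y * (1 - e) = y := by rw [hy, mul_assoc, ← hpc, ← mul_assoc, hpp]
    have hy0 : 0 ≤ y := by
      rw [← hyp, hy]
      exact hpsa.conjugate_nonneg hx
    rcases eq_or_ne y 0 with h0 | h0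
    · simp [h0]
    have hysa : IsSelfAdjoint y := IsSelfAdjoint.of_nonneg hy0
    have hny : ‖y‖ ≠ 0 := norm_ne_zero_iff.mpr h0
    set q := spectralProjection y ‖y‖ with hq
    have hq0 : q ≠ 0 := spectralProjection_norm_ne_zero hy0 h0
    have hqp : q * (1 - e) = q := by
      have h1 : q = ‖y‖⁻¹ • (q * y) := by
        rw [hq, spectralProjection_mul_right hysa, smul_smul, inv_mul_cancel₀ hny, one_smul]
      rw [h1, smul_mul_assoc, mul_assoc, hyp]
    -- Otherwise the top spectral projection `q` of `y` would lie in the ideal, whose unit `e` it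
    -- annihilates.
    have hlt : η < ‖φ q‖ := by
      by_contra! hle
      have hmem := (hφ.mem_smallIdeal_iff hη (spectralProjection_mul_self y ‖y‖)
        (IsSelfAdjoint.of_nonneg (spectralProjection_nonneg y _))).mpr hle
      apply hq0
      rw [← hqp, mul_sub, mul_one, hright q hmem, sub_self]
    have h2 : ‖y‖ • φ q ≤ φ y := by
      rw [← LinearMapClass.map_smul_of_tower φ]
      exact OrderHomClass.mono φ (smul_spectralProjection_le hy0 _)
    have h3 := CStarAlgebra.norm_le_norm_of_nonneg_of_le
      (smul_nonneg (norm_nonneg y) (map_nonneg φ (spectralProjection_nonneg y ‖y‖))) h2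
    rw [norm_smul, norm_norm] at h3
    refine le_trans ?_ h3
    rw [mul_comm]
    gcongr

end IsOrderZero

end OrderZero

lemma norm_le_one_of_projection {B : Type*} [CStarAlgebra B] {p : B} (hsa : IsSelfAdjoint p) (hpp : p * p = p) : ‖p‖ ≤ 1 := by
  have h := CStarRing.norm_star_mul_self (x := p)
  rw [hsa.star_eq, hpp] at h
  nlinarith [norm_nonneg p]

/-! ### Central cut-downs and norm bounds for positive functionals. -/

section Composition

variable {A B C : Type*} [CStarAlgebra A] [PartialOrder A] [StarOrderedRing A]
  [CStarAlgebra B] [PartialOrder B] [StarOrderedRing B]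
  [CStarAlgebra C] [PartialOrder C] [StarOrderedRing C]

/-- The composition of completely positive maps. -/
noncomputable def _root_.CompletelyPositiveMap.comp (g : B →CP C) (f : A →CP B) : A →CP C where
  toLinearMap := g.toLinearMap ∘ₗ f.toLinearMap
  map_cstarMatrix_nonneg' k M hM :=
    g.map_cstarMatrix_nonneg' k _ (f.map_cstarMatrix_nonneg' k M hM)

lemma _root_.CompletelyPositiveMap.comp_apply (g : B →CP C) (f : A →CP B) (x : A) :
    g.comp f x = g (f x) := rfl

/-- Multiplication by a central projection, as a completely positive map. -/
noncomputable def centralCut (p : B) (hsa : IsSelfAdjoint p) (hpp : p * p = p) (hp : ∀ x, p * x = x * p) :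
    B →CP B :=
  CompletelyPositiveMapClass.toCompletelyPositiveLinearMap
    ({ toFun := fun x => p * x
       map_smul' := fun c x => mul_smul_comm c p x
       map_zero' := mul_zero p
       map_add' := mul_add p
       map_mul' := fun x y => by
        rw [mul_assoc, ← mul_assoc x, ← hp x, ← mul_assoc, ← mul_assoc, ← mul_assoc, hpp, mul_assoc]
       map_star' := fun x => by rw [star_mul, hsa.star_eq, hp] } : B →⋆ₙₐ[ℂ] B)

open scoped ComplexOrder in
-- Compressing `-‖y‖ ≤ y ≤ ‖y‖` by the central projection `c` gives `-‖y‖ c ≤ c y ≤ ‖y‖ c`.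
lemma norm_map_mul_le_of_isSelfAdjoint (f : B →ₚ[ℂ] ℂ) {c : B} (hsa : IsSelfAdjoint c)
    (hcc : c * c = c) (hc : ∀ x, c * x = x * c) {y : B} (hy : IsSelfAdjoint y) :
    ‖f (c * y)‖ ≤ ‖y‖ * ‖f c‖ := by
  have hconj : ∀ z : B, c * z * c = c * z := fun z => by rw [mul_assoc, ← hc, ← mul_assoc, hcc]
  have h1 : c * y ≤ ‖y‖ • c := by
    have := hsa.conjugate_le_conjugate hy.le_algebraMap_norm_self
    rwa [hconj, hconj, Algebra.algebraMap_eq_smul_one, mul_smul_comm, mul_one] at this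
  have h2 : -(‖y‖ • c) ≤ c * y := by
    have := hsa.conjugate_le_conjugate hy.neg_algebraMap_norm_le_self
    rwa [hconj, hconj, Algebra.algebraMap_eq_smul_one, mul_neg, mul_smul_comm, mul_one] at this
  have h3 := OrderHomClass.mono f h1
  have h4 := OrderHomClass.mono f h2
  have hc0 : 0 ≤ f c := map_nonneg f (by rw [← hcc]; exact hsa.mul_self_nonneg)
  rw [f.map_smul_of_tower] at h3
  rw [map_neg, f.map_smul_of_tower] at h4
  rw [Complex.le_def] at h3 h4 hc0
  simp only [Complex.smul_re, Complex.smul_im, Complex.neg_re, smul_eq_mul,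
    Complex.zero_re, Complex.zero_im] at h3 h4 hc0
  have him : (f (c * y)).im = 0 := by rw [h3.2, ← hc0.2, mul_zero]
  have h5 : ‖f (c * y)‖ = |(f (c * y)).re| := by
    rw [Complex.norm_eq_sqrt_sq_add_sq, him]; simp [Real.sqrt_sq_eq_abs]
  rw [h5]
  refine (abs_le.mpr ⟨h4.1, h3.1⟩).trans ?_
  gcongr
  exact Complex.re_le_norm _

open scoped ComplexOrder in
-- The factor `2` comes from treating real and imaginary parts separately; no sharp constant is
-- needed.
lemma norm_map_mul_le (f : B →ₚ[ℂ] ℂ) {c : B} (hsa : IsSelfAdjoint c)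
    (hcc : c * c = c) (hc : ∀ x, c * x = x * c) (y : B) :
    ‖f (c * y)‖ ≤ 2 * ‖y‖ * ‖f c‖ := by
  have h1 := norm_map_mul_le_of_isSelfAdjoint f hsa hcc hc (realPart y).2
  have h2 := norm_map_mul_le_of_isSelfAdjoint f hsa hcc hc (imaginaryPart y).2
  have h3 : ‖(realPart y : B)‖ ≤ ‖y‖ := realPart.norm_le y
  have h4 : ‖(imaginaryPart y : B)‖ ≤ ‖y‖ := imaginaryPart.norm_le y
  calc ‖f (c * y)‖ = ‖f (c * (realPart y : B)) + Complex.I • f (c * (imaginaryPart y : B))‖ := by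
        rw [← map_smul, ← map_add, ← mul_smul_comm, ← mul_add, realPart_add_I_smul_imaginaryPart]
    _ ≤ ‖f (c * (realPart y : B))‖ + ‖f (c * (imaginaryPart y : B))‖ := by
        refine (norm_add_le _ _).trans ?_
        rw [norm_smul, Complex.norm_I, one_mul]
    _ ≤ ‖y‖ * ‖f c‖ + ‖y‖ * ‖f c‖ := by
        refine add_le_add (h1.trans ?_) (h2.trans ?_) <;> gcongr
    _ = _ := by ring

lemma TracialState.norm_apply_le (τ : TracialState B) (x : B) : ‖τ x‖ ≤ 2 * ‖x‖ := by
  have h := norm_map_mul_le τ.toPositiveLinearMap (IsSelfAdjoint.one B) (mul_one 1)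
    (fun x => by simp) x
  have h1 : τ.toPositiveLinearMap 1 = 1 := τ.map_one'
  rw [h1, one_mul, norm_one, mul_one] at h
  exact h

end Composition

/-! ### Passing from single summands to direct sums. -/

section DirectSum

variable {ι : Type*} [Fintype ι] [DecidableEq ι] {F : ι → Type*} [∀ i, CStarAlgebra (F i)]
  [∀ i, PartialOrder (F i)] [∀ i, StarOrderedRing (F i)] {A : Type*}
  [CStarAlgebra A] [PartialOrder A] [StarOrderedRing A]

/-- The inclusion of a direct summand, as a completely positive map. -/
noncomputable def singleCP (F : ι → Type*) [∀ i, CStarAlgebra (F i)]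
    [∀ i, PartialOrder (F i)] [∀ i, StarOrderedRing (F i)] (i : ι) : F i →CP ((i : ι) → F i) :=
  CompletelyPositiveMapClass.toCompletelyPositiveLinearMap
    ({ toFun := Pi.single i
       map_smul' := fun c x => Pi.single_smul i c x
       map_zero' := Pi.single_zero i
       map_add' := Pi.single_add i
       map_mul' := Pi.single_mul i
       map_star' := fun x => (Pi.single_star i x) } : F i →⋆ₙₐ[ℂ] ((i : ι) → F i))

lemma singleCP_apply (i : ι) (x : F i) : singleCP F i x = Pi.single i x := rfl

lemma map_eq_sum_single (φ : ((i : ι) → F i) →CP A) (x : (i : ι) → F i) :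
    φ x = ∑ i, φ.comp (singleCP F i) (x i) := by
  conv_lhs => rw [← Finset.univ_sum_single x, map_sum]
  rfl

variable [∀ i, FiniteDimensional ℂ (F i)]

/-- A central projection cutting off the part of a direct sum on which a sum of order zero maps is
small. -/
lemma exists_central_projection_pi {φ : ((i : ι) → F i) →CP A}
    (hφ : ∀ i, IsOrderZero (φ.comp (singleCP F i))) {η : ℝ} (hη : 0 < η) :
    ∃ p : (i : ι) → F i, IsSelfAdjoint p ∧ p * p = p ∧ (∀ x, p * x = x * p) ∧
      ‖φ (1 - p)‖ ≤ Fintype.card ι * η ∧ ∀ x, 0 ≤ x → η * ‖p * x‖ ≤ ‖φ x‖ := by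
  choose p hsa hpp hcen hsmall hbig using fun i => (hφ i).exists_central_projection hη
  have hsa' : IsSelfAdjoint p := funext hsa
  have hpp' : p * p = p := funext hpp
  have hcen' : ∀ x, p * x = x * p := fun x => funext fun i => hcen i (x i)
  refine ⟨p, hsa', hpp', hcen', ?_, fun x hx => ?_⟩
  · rw [map_eq_sum_single]
    refine (norm_sum_le _ _).trans ((Finset.sum_le_card_nsmul _ _ η fun i _ => hsmall i).trans ?_)
    simp
  · rw [mul_comm, ← le_div_iff₀ hη, pi_norm_le_iff_of_nonneg (by positivity)]
    intro i
    rw [le_div_iff₀ hη, mul_comm]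
    refine (hbig i (x i) (hx i)).trans ?_
    -- The element `p i * x i`, placed in the `i`-th summand, is positive and lies below `x`;
    -- monotonicity of `φ` then transfers the lower bound.
    have h0 : ∀ j, 0 ≤ p j * x j := fun j => by
      have := (hsa j).conjugate_nonneg (hx j)
      rwa [mul_assoc, ← hcen, ← mul_assoc, hpp] at this
    have h1 : ∀ j, p j * x j ≤ x j := fun j => by
      have := ((IsSelfAdjoint.one _).sub (hsa j)).conjugate_nonneg (hx j)
      rw [mul_assoc, mul_sub (x j), ← hcen, mul_one, sub_mul, one_mul, mul_sub (p j), ← mul_assoc,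
        hpp, sub_self, sub_zero] at this
      exact sub_nonneg.mp this
    refine CStarAlgebra.norm_le_norm_of_nonneg_of_le
      (map_nonneg (φ.comp (singleCP F i)) (h0 i)) ?_
    rw [CompletelyPositiveMap.comp_apply, singleCP_apply]
    refine OrderHomClass.mono φ fun j => ?_
    rcases eq_or_ne j i with rfl | hj
    · simpa using h1 j
    · simpa [hj] using hx j

lemma map_mul_comm_of_trace_pi {φ : ((i : ι) → F i) →CP A} (hc : IsContractive φ)
    (hφ : ∀ i, IsOrderZero (φ.comp (singleCP F i))) (τ : TracialState A)
    (x y : (i : ι) → F i) : τ (φ (x * y)) = τ (φ (y * x)) := by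
  have h : ∀ z, τ (φ z) = ∑ i, τ.toPositiveLinearMap (φ.comp (singleCP F i) (z i)) := fun z => by
    rw [map_eq_sum_single]
    exact map_sum τ.toPositiveLinearMap _ _
  rw [h, h]
  refine Finset.sum_congr rfl fun i _ => ?_
  exact (hφ i).map_mul_comm_of_trace
    (fun z => (hc _).trans (Pi.norm_single z).le) _ τ.map_mul_comm' _ _

end DirectSum

/-! ### From decomposable systems to quasidiagonal systems. -/

variable {A : Type*} [CStarAlgebra A]

/-- The enlargement of a set by the unit and the elements `a * star a`. -/
def squareClosure (𝓕 : Set A) : Set A := insert 1 (𝓕 ∪ (fun a => a * star a) '' 𝓕)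

lemma squareClosure_finite {𝓕 : Set A} (h : 𝓕.Finite) : (squareClosure 𝓕).Finite :=
  (h.union (h.image _)).insert 1

lemma exists_norm_bound {𝓕 : Set A} (h : 𝓕.Finite) : ∃ M : ℝ, 1 ≤ M ∧ ∀ a ∈ 𝓕, ‖a‖ ≤ M := by
  obtain ⟨M, hM⟩ := (h.image norm).bddAbove
  exact ⟨max 1 M, le_max_left _ _, fun a ha => (hM ⟨a, ha, rfl⟩).trans (le_max_right _ _)⟩

/-- Since `α` preserves `a * star a`, enlarging `𝓕` once suffices for every `n`; since `α` is
contractive, the bound `M` does not depend on `n`. -/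
lemma orbitUnion_squareClosure (α : A →⋆ₙₐ[ℂ] A) {𝓕 : Set A} {M : ℝ}
    (hbound : ∀ a ∈ 𝓕, ‖a‖ ≤ M) (n : ℕ) {a : A} (ha : a ∈ orbitUnion α 𝓕 n) :
    ‖a‖ ≤ M ∧ a ∈ orbitUnion α (squareClosure 𝓕) n ∧
      a * star a ∈ orbitUnion α (squareClosure 𝓕) n := by
  simp only [orbitUnion, Set.mem_iUnion] at ha ⊢
  obtain ⟨k, hk, b, hb, rfl⟩ := ha
  refine ⟨?_, ⟨k, hk, b, Or.inr (Or.inl hb), rfl⟩,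
    ⟨k, hk, b * star b, Or.inr (Or.inr ⟨b, hb, rfl⟩), ?_⟩⟩
  · refine le_trans ?_ (hbound b hb)
    clear hk
    induction k with
    | zero => simp
    | succ k ih =>
      rw [Function.iterate_succ_apply']
      exact (NonUnitalStarAlgHom.norm_apply_le α _).trans ih
  · clear hk
    induction k with
    | zero => simp
    | succ k ih => simp only [Function.iterate_succ_apply', ih, map_mul, map_star]

variable [PartialOrder A] [StarOrderedRing A]

/-- The direct sum of finitely many finite-dimensional C*-algebras. -/
noncomputable def FinDimCStarAlg.pi {d : ℕ} (F : Fin (d + 1) → FinDimCStarAlg) : FinDimCStarAlg :=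
  ⟨(i : Fin (d + 1)) → F i⟩

open scoped ComplexOrder in
/-- The normalization of a positive tracial functional. -/
noncomputable def TracialState.normalize {F : Type*} [CStarAlgebra F] [PartialOrder F]
    [StarOrderedRing F] (f : F →ₚ[ℂ] ℂ) (hf : ∀ a b, f (a * b) = f (b * a)) (h1 : f 1 ≠ 0) :
    TracialState F where
  toLinearMap := (f 1)⁻¹ • f.toLinearMap
  monotone' a b hab := by
    have h := OrderHomClass.mono f hab
    have h0 : 0 ≤ (f 1)⁻¹ := inv_nonneg.mpr (map_nonneg f zero_le_one)
    exact mul_le_mul_of_nonneg_left h h0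
  map_one' := inv_mul_cancel₀ h1
  map_mul_comm' a b := congrArg ((f 1)⁻¹ * ·) (hf a b)

/-- In a decomposable system the downward map is almost multiplicative, measured after applying the
upward map. -/
lemma IsContractiveDecomposableSystem.norm_map_defect_le {d : ℕ} {𝓖 : Set A} {δ : ℝ}
    {F : Fin (d + 1) → FinDimCStarAlg} {ψ : A →CP ((i : Fin (d + 1)) → F i)}
    {φ : ((i : Fin (d + 1)) → F i) →CP A} (h : IsContractiveDecomposableSystem d 𝓖 δ F ψ φ)
    {a : A} {M : ℝ} (hM : 1 ≤ M) (haM : ‖a‖ ≤ M) (ha : a ∈ 𝓖) (haa : a * star a ∈ 𝓖) :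
    ‖φ (ψ (a * star a) - ψ a * star (ψ a))‖ ≤ 3 * M * δ := by
  have hdn : 0 ≤ ψ (a * star a) - ψ a * star (ψ a) := by
    have := CompletelyPositiveMap.star_map_mul_map_le h.contractive_down (star a)
    simpa [map_star] using this
  -- Kadison for `φ` bounds the image of the defect by the defect of `φ ∘ ψ`, which is small because
  -- `φ ∘ ψ` is close to the identity at `a` and `a * star a`.
  have hup : φ (ψ a) * star (φ (ψ a)) ≤ φ (ψ a * star (ψ a)) := by
    have := CompletelyPositiveMap.star_map_mul_map_le h.contractive_up (star (ψ a))
    simpa [map_star] using this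
  have hle : φ (ψ (a * star a) - ψ a * star (ψ a))
      ≤ φ (ψ (a * star a)) - φ (ψ a) * star (φ (ψ a)) := by
    rw [map_sub]
    exact sub_le_sub_left hup _
  refine (CStarAlgebra.norm_le_norm_of_nonneg_of_le (map_nonneg φ hdn) hle).trans ?_
  have e : φ (ψ (a * star a)) - φ (ψ a) * star (φ (ψ a))
      = (φ (ψ (a * star a)) - a * star a) - ((φ (ψ a) - a) * star (φ (ψ a))
        + a * star (φ (ψ a) - a)) := by
    rw [star_sub]; noncomm_ring
  have h1 := h.approx _ ha
  have h2 := h.approx _ haa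
  have h3 : ‖φ (ψ a)‖ ≤ M := (h.contractive_up _).trans ((h.contractive_down _).trans haM)
  have hδ : 0 ≤ δ := (norm_nonneg _).trans h1
  rw [e]
  calc _ ≤ ‖φ (ψ (a * star a)) - a * star a‖ + (‖φ (ψ a) - a‖ * ‖φ (ψ a)‖
        + ‖a‖ * ‖φ (ψ a) - a‖) := by
        refine (norm_sub_le _ _).trans (add_le_add le_rfl ((norm_add_le _ _).trans ?_))
        refine add_le_add ((norm_mul_le _ _).trans ?_) ((norm_mul_le _ _).trans ?_) <;>
        rw [norm_star]
    _ ≤ δ + (δ * M + M * δ) := by gcongr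
    _ ≤ 3 * M * δ := by nlinarith

open scoped ComplexOrder in
/-- A sufficiently good decomposable system yields a quasidiagonal system for every trace, with the
same finite-dimensional algebra. -/
lemma IsContractiveDecomposableSystem.exists_isQuasidiagonalSystem {d : ℕ} {𝓖 : Set A} {δ : ℝ}
    {F : Fin (d + 1) → FinDimCStarAlg} {ψ : A →CP ((i : Fin (d + 1)) → F i)}
    {φ : ((i : Fin (d + 1)) → F i) →CP A} (h : IsContractiveDecomposableSystem d 𝓖 δ F ψ φ)
    (τ : TracialState A) {𝓕 : Set A} {M η ε : ℝ} (hM : 1 ≤ M) (hη : 0 < η) (hε : 0 ≤ ε)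
    (hδ : δ ≤ 1 / 4) (hmul : M ^ 2 * (3 * M * δ) ≤ ε ^ 2 * η)
    (htr : 6 * M * δ + 4 * M * (d + 1) * η ≤ ε) (h1 : 1 ∈ 𝓖)
    (h𝓕 : ∀ a ∈ 𝓕, ‖a‖ ≤ M ∧ a ∈ 𝓖 ∧ a * star a ∈ 𝓖) :
    ∃ (τF : TracialState (FinDimCStarAlg.pi F)) (θ : A →CP (FinDimCStarAlg.pi F)),
      IsQuasidiagonalSystem τ 𝓕 ε (FinDimCStarAlg.pi F) τF θ := by
  have hoz : ∀ i, IsOrderZero (φ.comp (singleCP (fun i => F i) i)) := h.orderZero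
  obtain ⟨p, hsa, hpp, hcen, hsmall, hbig⟩ := exists_central_projection_pi hoz hη
  rw [Fintype.card_fin, Nat.cast_add, Nat.cast_one] at hsmall
  have hp1 : ‖p‖ ≤ 1 := norm_le_one_of_projection hsa hpp
  let f := τ.toPositiveLinearMap.comp (PositiveLinearMap.ofClass φ)
  have hf : ∀ x, f x = τ (φ x) := fun x => rfl
  have hδ0 : 0 ≤ δ := (norm_nonneg _).trans (h.approx 1 h1)
  -- `φ` need not be unital, but `φ (ψ 1) ≤ φ 1 ≤ 1` and `φ (ψ 1)` is within `δ` of `1`.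
  have hs : ‖1 - f 1‖ ≤ 2 * δ := by
    have hφ1 : 0 ≤ 1 - φ 1 :=
      sub_nonneg.mpr (CompletelyPositiveMap.map_one_le_one h.contractive_up)
    have hle : 1 - φ 1 ≤ 1 - φ (ψ 1) := sub_le_sub_left
      (OrderHomClass.mono φ (CompletelyPositiveMap.map_one_le_one h.contractive_down)) _
    have e : 1 - f 1 = τ (1 - φ 1) := by
      rw [hf]
      exact (congrArg (· - τ (φ 1)) τ.map_one'.symm).trans
        (map_sub τ.toPositiveLinearMap 1 (φ 1)).symm
    rw [e]
    refine (τ.norm_apply_le _).trans (mul_le_mul_of_nonneg_left ?_ zero_le_two)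
    refine (CStarAlgebra.norm_le_norm_of_nonneg_of_le hφ1 hle).trans ?_
    rw [norm_sub_rev]
    exact h.approx 1 h1
  have hs0 : f 1 ≠ 0 := by
    intro h0
    rw [h0, sub_zero, norm_one] at hs
    linarith
  let τF := TracialState.normalize f
    (fun x y => map_mul_comm_of_trace_pi h.contractive_up hoz τ x y) hs0
  have hτF : ∀ x, τF x = (f 1)⁻¹ * f x := fun x => rfl
  let θ := (centralCut p hsa hpp hcen).comp ψ
  have hθ : ∀ a, θ a = p * ψ a := fun a => rfl
  have hθc : IsContractive θ := fun a => by
    rw [hθ]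
    refine (norm_mul_le _ _).trans ?_
    calc ‖p‖ * ‖ψ a‖ ≤ 1 * ‖a‖ := by gcongr; exact h.contractive_down a
      _ = ‖a‖ := one_mul _
  refine ⟨τF, θ, hθc, fun a ha b hb => ?_, fun a ha => ?_⟩
  · obtain ⟨haM, haG, haaG⟩ := h𝓕 a ha
    obtain ⟨hbM, -, -⟩ := h𝓕 b hb
    have k1 := CompletelyPositiveMap.norm_map_mul_sub_sq_le hθc a b
    have e : θ (a * star a) - θ a * star (θ a) = p * (ψ (a * star a) - ψ a * star (ψ a)) := by
      have e0 : p * ψ a * (star (ψ a) * p) = p * (ψ a * star (ψ a)) := by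
        rw [← hcen (star (ψ a)), mul_assoc, ← mul_assoc (ψ a), ← hcen (ψ a), mul_assoc p (ψ a),
          ← mul_assoc p p, hpp]
      rw [hθ, hθ, star_mul, hsa.star_eq, mul_sub, e0]
    have hdn : 0 ≤ ψ (a * star a) - ψ a * star (ψ a) := by
      have := CompletelyPositiveMap.star_map_mul_map_le h.contractive_down (star a)
      simpa [map_star] using this
    -- The lower bound on `pF` converts smallness after `φ` into smallness in `F`, at the cost of a
    -- factor `1 / η`.
    have k2 := (hbig _ hdn).trans (h.norm_map_defect_le hM haM haG haaG)
    rw [← e] at k2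
    refine le_of_sq_le_sq ?_ hε
    refine k1.trans (le_of_mul_le_mul_right ?_ hη)
    calc ‖b‖ ^ 2 * ‖θ (a * star a) - θ a * star (θ a)‖ * η
        = ‖b‖ ^ 2 * (η * ‖θ (a * star a) - θ a * star (θ a)‖) := by ring
      _ ≤ M ^ 2 * (3 * M * δ) := by gcongr
      _ ≤ ε ^ 2 * η := hmul
  · obtain ⟨haM, haG, -⟩ := h𝓕 a ha
    have hψ : ‖ψ a‖ ≤ M := (h.contractive_down a).trans haM
    -- The trace error has three sources: `φ ∘ ψ` versus the identity, the cut by `p`, and the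
    -- normalization of `f`.
    have k1 : ‖τ a - f (ψ a)‖ ≤ 2 * δ := by
      have e : τ a - f (ψ a) = τ (a - φ (ψ a)) :=
        (map_sub τ.toPositiveLinearMap a (φ (ψ a))).symm
      rw [e]
      refine (τ.norm_apply_le _).trans (mul_le_mul_of_nonneg_left ?_ zero_le_two)
      rw [norm_sub_rev]
      exact h.approx a haG
    have k2 : ‖f (ψ a) - f (θ a)‖ ≤ 4 * M * (d + 1) * η := by
      have e : f (ψ a) - f (θ a) = f ((1 - p) * ψ a) := by
        rw [← map_sub, hθ, sub_mul, one_mul]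
      rw [e]
      refine (norm_map_mul_le f ((IsSelfAdjoint.one _).sub hsa) ?_ (fun x => ?_) _).trans ?_
      · rw [mul_sub, sub_mul, sub_mul, hpp]; simp
      · rw [sub_mul, mul_sub, hcen, one_mul, mul_one]
      · have := (τ.norm_apply_le (φ (1 - p))).trans (mul_le_mul_of_nonneg_left hsmall zero_le_two)
        calc 2 * ‖ψ a‖ * ‖f (1 - p)‖ ≤ 2 * M * (2 * ((d + 1) * η)) := by gcongr; exact this
          _ = _ := by ring
    have k3 : ‖f (θ a) - τF (θ a)‖ ≤ 4 * M * δ := by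
      have e : f (θ a) - τF (θ a) = -((1 - f 1) * τF (θ a)) := by
        rw [hτF]; field_simp; ring
      rw [e, norm_neg, norm_mul]
      have := (τF.norm_apply_le (θ a)).trans
        (mul_le_mul_of_nonneg_left ((hθc a).trans haM) zero_le_two)
      calc ‖1 - f 1‖ * ‖τF (θ a)‖ ≤ 2 * δ * (2 * M) := by gcongr
        _ = _ := by ring
    have k : ‖(τ a - f (ψ a)) + (f (ψ a) - f (θ a)) + (f (θ a) - τF (θ a))‖ ≤ ε := by
      refine norm_add₃_le.trans ?_
      linarith [mul_le_mul_of_nonneg_right hM hδ0]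
    rwa [sub_add_sub_cancel, sub_add_sub_cancel] at k

/-- A tolerance for decomposable systems that suffices to obtain quasidiagonal systems. -/
lemma exists_tolerance (d : ℕ) {M ε : ℝ} (hM : 1 ≤ M) (hε : 0 < ε) :
    ∃ δ > 0, ∀ (τ : TracialState A) (𝓕 𝓖 : Set A), 1 ∈ 𝓖 →
      (∀ a ∈ 𝓕, ‖a‖ ≤ M ∧ a ∈ 𝓖 ∧ a * star a ∈ 𝓖) →
      ∀ (F : Fin (d + 1) → FinDimCStarAlg) (ψ : A →CP ((i : Fin (d + 1)) → F i))
        (φ : ((i : Fin (d + 1)) → F i) →CP A), IsContractiveDecomposableSystem d 𝓖 δ F ψ φ →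
        ∃ (τF : TracialState (FinDimCStarAlg.pi F)) (θ : A →CP (FinDimCStarAlg.pi F)),
          IsQuasidiagonalSystem τ 𝓕 ε (FinDimCStarAlg.pi F) τF θ := by
  have hM0 : 0 < M := by linarith
  -- The cut costs `4 * M * (d + 1) * η = ε / 2` in trace; the three bounds on `δ` give `f 1 ≠ 0`,
  -- the remaining trace error `6 * M * δ ≤ ε / 2`, and `3 * M ^ 3 * δ ≤ ε ^ 2 * η` for
  -- multiplicativity.
  set η := ε / (8 * M * (d + 1)) with hη
  have hη0 : 0 < η := by positivity
  set δ := min (1 / 4) (min (ε / (12 * M)) (ε ^ 2 * η / (3 * M ^ 3))) with hδ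
  have hδ1 : δ ≤ 1 / 4 := min_le_left _ _
  have hδ2 : δ ≤ ε / (12 * M) := (min_le_right _ _).trans (min_le_left _ _)
  have hδ3 : δ ≤ ε ^ 2 * η / (3 * M ^ 3) := (min_le_right _ _).trans (min_le_right _ _)
  refine ⟨δ, lt_min (by norm_num) (lt_min (by positivity) (by positivity)),
    fun τ 𝓕 𝓖 h1 h𝓕 F ψ φ h => ?_⟩
  refine h.exists_isQuasidiagonalSystem τ hM hη0 hε.le hδ1 ?_ ?_ h1 h𝓕
  · rw [le_div_iff₀ (by positivity)] at hδ3
    linarith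
  · rw [le_div_iff₀ (by positivity)] at hδ2
    have : 4 * M * (d + 1) * η = ε / 2 := by rw [hη]; field_simp; norm_num
    linarith

/-! ### Quasidiagonality and comparison of entropies. -/

lemma isQuasidiagonal_of_decompositionRankLE {d : ℕ} (hd : DecompositionRankLE A d)
    (τ : TracialState A) : IsQuasidiagonal τ := by
  intro 𝓕 h𝓕 ε hε
  obtain ⟨M, hM, hbound⟩ := exists_norm_bound h𝓕
  obtain ⟨δ, hδ, h⟩ := exists_tolerance (A := A) d hM hε
  obtain ⟨F, ψ, φ, hsys⟩ := hd (squareClosure 𝓕) (squareClosure_finite h𝓕) δ hδ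
  obtain ⟨τF, θ, hqd⟩ := h τ 𝓕 (squareClosure 𝓕) (Set.mem_insert _ _)
    (fun a ha => ⟨hbound a ha, Or.inr (Or.inl ha), Or.inr (Or.inr ⟨a, ha, rfl⟩)⟩) F ψ φ hsys
  exact ⟨_, τF, θ, hqd⟩

/-- The pair `(squareClosure 𝓕, δ)` on the decomposable side dominates `(𝓕, ε)` on the quasidiagonal
side for every `n > 0`, because the finite-dimensional algebra is unchanged. -/
lemma hqd_le_entropyOfRank (d : ℕ) (τ : TracialState A) (α : A →⋆ₙₐ[ℂ] A) :
    hqd τ α ≤ entropyOfRank (contractiveDecomposableRank d) α := by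
  refine iSup₂_le fun 𝓕 h𝓕 => iSup₂_le fun ε hε => ?_
  obtain ⟨M, hM, hbound⟩ := exists_norm_bound h𝓕
  obtain ⟨δ, hδ, h⟩ := exists_tolerance (A := A) d hM hε
  refine le_trans ?_ (le_iSup₂_of_le (squareClosure 𝓕) (squareClosure_finite h𝓕)
    (le_iSup₂_of_le δ hδ le_rfl))
  refine Filter.limsup_le_limsup ?_
  filter_upwards [Filter.eventually_gt_atTop 0] with n hn
  refine EReal.div_le_div_right_of_nonneg (by positivity) (ENNReal.log_le_log ?_)
  refine ENat.toENNReal_le.mpr (le_sInf ?_)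
  rintro r ⟨F, ψ, φ, hsys, rfl⟩
  -- The unit is taken from the term `k = 0`, which requires `n > 0`: later iterates may move it, as
  -- `α` need not be unital.
  obtain ⟨τF, θ, hqd⟩ := h τ (orbitUnion α 𝓕 n) (orbitUnion α (squareClosure 𝓕) n)
    (Set.mem_biUnion (x := 0) hn ⟨1, Set.mem_insert _ _, rfl⟩)
    (fun a ha => orbitUnion_squareClosure α hbound n ha) F ψ φ hsys
  exact sInf_le ⟨FinDimCStarAlg.pi F, τF, θ, hqd, rfl⟩

lemma exists_decompositionRankLE (h : decompositionRank A < ⊤) :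
    ∃ d, DecompositionRankLE A d := by
  by_contra! hno
  simp [decompositionRank, hno] at h

end ColouredEntropy

theorem proposition5p3 {A : Type*} [CStarAlgebra A] [PartialOrder A] [StarOrderedRing A]
    (hsimple : ColouredEntropy.IsSimpleCStarAlgebra A)
    (hdr : ColouredEntropy.decompositionRank A < ⊤)
    (α : A →⋆ₙₐ[ℂ] A) (τ : ColouredEntropy.TracialState A) :
    ColouredEntropy.IsQuasidiagonal τ ∧
      ColouredEntropy.hqd τ α ≤ ColouredEntropy.htDr α := by
  obtain ⟨d, hd⟩ := ColouredEntropy.exists_decompositionRankLE hdr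
  refine ⟨ColouredEntropy.isQuasidiagonal_of_decompositionRankLE hd τ, ?_⟩
  rw [ColouredEntropy.htDr, if_neg hdr.ne]
  exact ColouredEntropy.hqd_le_entropyOfRank _ τ α
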